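/- Let $W:\mathbb R\to[0,\infty)$ be even and of class $C^3$, with $\{W=0\}=\{-1,1\}$ and $W''(\pm1)=\lambda>0$. For $s\in(0,1)$ let $w:\mathbb R\to(-1,1)$ be the optimal profile for $(s,W)$, i.e. the strictly increasing function of class $C^2$ with $$(-\partial_{zz})^s w+W'(w)=0 \ \text{ in } \mathbb R,\qquad w(0)=0,\qquad \lim_{z\to\pm\infty}w(z)=\pm1,$$ where $$(-\partial_{zz})^s u(x)=\gamma_{1,s}\lim_{\nu\to0^+}\int_{|x-y|\ge\nu}\frac{u(x)-u(y)}{|x-y|^{1+2s}}\,dy,\qquad \gamma_{1,s}=s\,2^{2s}\pi^{-1/2}\,\frac{\Gamma\left(\frac{1+2s}{2}\right)}{\Gamma(1-s)}.$$ For $s\in(1/2,1)$ and $L>0$ set $$\eta_{1,L}(z)=\int_{-L}^{L}\frac{w'(z+t)}{|t|^{2s-1}}\,dt .$$ (i) If $s\in(3/4,1)$, there is a constant $\mu_w\in(0,\infty)$, which for fixed $s$ depends only on $w$, such that for all $\ell,\ell'>0$ $$\lim_{\varepsilon\to0^+}\int_{-\ell'/\varepsilon}^{\ell'/\varepsilon}\eta_{1,\ell/\varepsilon}(z)^2\,dz=\mu_w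 .$$ In particular $\mu_w$ is independent of $\ell$ and $\ell'$. (ii) If $s=3/4$, then for all $\ell,\ell'>0$ $$\lim_{\varepsilon\to0^+}\frac1{|\log\varepsilon|}\int_{-\ell'/\varepsilon}^{\ell'/\varepsilon}\eta_{1,\ell/\varepsilon}(z)^2\,dz=8 .$$ -/

import Mathlib

open Filter Topology MeasureTheory

noncomputable section

namespace FracAllenCahn

/-- A double-well potential: nonnegative, even, vanishing exactly at `1` and `-1`, of class `C³`,
with `W''(1) = W''(-1) > 0`. -/
structure IsDoubleWell (W : ℝ → ℝ) : Prop where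
  nonneg : ∀ x, 0 ≤ W x
  even : ∀ x, W (-x) = W x
  zero_iff : ∀ x, W x = 0 ↔ x = 1 ∨ x = -1
  contDiff : ContDiff ℝ 3 W
  second_deriv : ∃ lam : ℝ, 0 < lam ∧ iteratedDeriv 2 W 1 = lam ∧ iteratedDeriv 2 W (-1) = lam

/-- The normalising constant `γ_{d,s} = s 2^{2s} π^{-d/2} Γ((d+2s)/2) / Γ(1-s)`. -/
def fracConst (d : ℕ) (s : ℝ) : ℝ :=
  s * (2 : ℝ) ^ (2 * s) * Real.pi ^ (-((d : ℝ) / 2)) * Real.Gamma (((d : ℝ) + 2 * s) / 2) /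
    Real.Gamma (1 - s)

/-- `HasFracLaplacianAt s u x a`: the principal value
`γ_{1,s} lim_{ν → 0⁺} ∫_{|x-y| ≥ ν} (u(x) - u(y)) / |x-y|^{1+2s} dy`
defining the one-dimensional fractional Laplacian of `u` at `x` exists and equals `a`. -/
def HasFracLaplacianAt (s : ℝ) (u : ℝ → ℝ) (x a : ℝ) : Prop :=
  Tendsto
    (fun ν : ℝ => fracConst 1 s * ∫ y in {y : ℝ | ν ≤ |x - y|}, (u x - u y) / |x - y| ^ (1 + 2 * s))
    (𝓝[>] 0) (𝓝 a)

/-- `w` is the optimal profile for `s` and `W`: the strictly increasing classical solution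
`w : ℝ → (-1,1)` of `(-∂_{zz})^s w + W'(w) = 0` with `w(0) = 0` and `w(±∞) = ±1`.
The fractional Laplacian is the pointwise principal value, defined for bounded functions of class
`C²`; boundedness of `w` is part of `w : ℝ → (-1,1)`. No bound on derivatives is required. -/
structure IsOptimalProfile (s : ℝ) (W w : ℝ → ℝ) : Prop where
  contDiff : ContDiff ℝ 2 w
  strictMono : StrictMono w
  mem_Ioo : ∀ z, w z ∈ Set.Ioo (-1 : ℝ) 1
  equation : ∀ z, HasFracLaplacianAt s w z (-deriv W (w z))
  zero : w 0 = 0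
  tendsto_atTop : Tendsto w atTop (𝓝 1)
  tendsto_atBot : Tendsto w atBot (𝓝 (-1))

/-- The rescaled profile `w_ε(z) = w(z/ε)`. -/
def rescale (w : ℝ → ℝ) (ε : ℝ) : ℝ → ℝ := fun z => w (z / ε)

/-- `η_{ε,ℓ}(z₀) = ∫_{-ℓ}^{ℓ} w_ε'(z₀ + z) / |z|^{2s-1} dz`. -/
def eta (s : ℝ) (w : ℝ → ℝ) (ε l z₀ : ℝ) : ℝ :=
  ∫ z in (-l)..l, deriv (rescale w ε) (z₀ + z) / |z| ^ (2 * s - 1)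

end FracAllenCahn

end

namespace FracAllenCahn
open Set
open scoped ENNReal

/-! The density `w'` is nonnegative with total mass `2`, and `η` is its correlation with the kernel
`|t|^{1-2s}` cut off to a window. Everything rests on the L² size of this correlation, estimated by
splitting the kernel at distance one.

Far part: Cauchy–Schwarz for the measure `w' dt` and Tonelli bound the squared integral by four
times that of the kernel (`setLIntegral_potential_far_sq_le`). The squared kernel decays like
`|t|^{-(4s-2)}`, which is integrable at infinity exactly for `s > 3/4`. At `s = 3/4` it is `1/|t|`,
and a window of radius `R` yields `8 log R + O(1)`.

Near part: the kernel is integrable, so this part lies in L¹, and a sup bound puts it in L². No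
bound on `w'` is assumed, so the sup bound comes from the equation (`exists_nearPotential_le`). Two
integrations by parts turn the derivative of the near potential into a truncated fractional
Laplacian, controlled by `W'(w)`, plus bounded terms and the derivative of the bounded function
`w(z+1) - w(z-1)`. The near potential is thus Lipschitz up to a bounded error, and a nonnegative
integrable function of this kind is bounded.

For `s > 3/4` the square of the full potential dominates, and dominated convergence identifies `μ_w`
as its integral. For `s = 3/4` the near part contributes only `O(1)`, so the upper constant is `8`.
From below, the mass in `[-A, A]` alone produces `2 (w A - w (-A))² |log ε|`, whose coefficient
tends to `2 · 2² = 8` as `A → ∞`. -/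

/-! ### The principal value as an integral of second differences. -/

theorem setOf_le_abs_sub (x ν : ℝ) :
    {y : ℝ | ν ≤ |x - y|} = Ici (x + ν) ∪ Iic (x - ν) := by
  ext y
  simp only [mem_ofPred_eq, mem_union, mem_Ici, mem_Iic, le_abs]
  constructor
  · rintro (h | h)
    · right; linarith
    · left; linarith
  · rintro (h | h)
    · right; linarith
    · left; linarith

theorem integrableOn_Ici_add_iff (g : ℝ → ℝ) (x ν : ℝ) :
    IntegrableOn (fun t => g (x + t)) (Ioi ν) ↔ IntegrableOn g (Ici (x + ν)) := by
  rw [integrableOn_Ici_iff_integrableOn_Ioi]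
  have := (measurePreserving_add_left volume x).integrableOn_comp_preimage
    (MeasurableEquiv.addLeft x).measurableEmbedding (f := g) (s := Ioi (x + ν))
  simpa [Function.comp_def] using this

theorem integrableOn_Iic_sub_iff (g : ℝ → ℝ) (x ν : ℝ) :
    IntegrableOn (fun t => g (x - t)) (Ioi ν) ↔ IntegrableOn g (Iic (x - ν)) := by
  rw [integrableOn_Iic_iff_integrableOn_Iio]
  have := (Measure.measurePreserving_sub_left volume x).integrableOn_comp_preimage
    (MeasurableEquiv.subLeft x).measurableEmbedding (f := g) (s := Iio (x - ν))
  simpa [Function.comp_def] using this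

theorem setIntegral_le_abs_sub {g : ℝ → ℝ} {x ν : ℝ} (hν : 0 < ν)
    (h₁ : IntegrableOn (fun t => g (x + t)) (Ioi ν))
    (h₂ : IntegrableOn (fun t => g (x - t)) (Ioi ν)) :
    ∫ y in {y : ℝ | ν ≤ |x - y|}, g y = ∫ t in Ioi ν, (g (x + t) + g (x - t)) := by
  rw [integral_add h₁ h₂, setOf_le_abs_sub x ν, setIntegral_union]
  · congr 1
    · rw [integral_Ici_eq_integral_Ioi, ← (measurePreserving_add_left volume x).setIntegral_preimage_emb
        (MeasurableEquiv.addLeft x).measurableEmbedding]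
      simp
    · rw [integral_Iic_eq_integral_Iio, ← (Measure.measurePreserving_sub_left volume x).setIntegral_preimage_emb
        (MeasurableEquiv.subLeft x).measurableEmbedding]
      simp
  · rw [Set.disjoint_left]
    intro y hy hy'
    simp only [mem_Ici, mem_Iic] at hy hy'
    linarith
  · exact measurableSet_Iic
  · exact (integrableOn_Ici_add_iff g x ν).1 h₁
  · exact (integrableOn_Iic_sub_iff g x ν).1 h₂

/-- The symmetric second difference of `u` at `x`. -/
def secondDiff (u : ℝ → ℝ) (x t : ℝ) : ℝ := u (x + t) + u (x - t) - 2 * u x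

theorem integrableOn_Ioi_bdd_mul_rpow {g : ℝ → ℝ} (hg : Continuous g) {M : ℝ} (hM : ∀ t, |g t| ≤ M)
    {p : ℝ} (hp : 1 < p) {ν : ℝ} (hν : 0 < ν) : IntegrableOn (fun t => g t * t ^ (-p)) (Ioi ν) := by
  refine Integrable.bdd_mul (c := M) (integrableOn_Ioi_rpow_of_lt (by linarith) hν)
    hg.aestronglyMeasurable (ae_of_all _ fun t => by simpa using hM t)

theorem abs_setIntegral_Ioi_bdd_mul_rpow_le {g : ℝ → ℝ} {M : ℝ}
    (hM : ∀ t, |g t| ≤ M) {p : ℝ} (hp : 1 < p) :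
    |∫ t in Ioi (1 : ℝ), g t * t ^ (-p)| ≤ M / (p - 1) := by
  have h1 : ∫ t in Ioi (1 : ℝ), M * t ^ (-p) = M / (p - 1) := by
    rw [integral_const_mul, integral_Ioi_rpow_of_lt (by linarith) one_pos]
    rw [Real.one_rpow, show -p + 1 = -(p - 1) by ring, neg_div_neg_eq, mul_one_div]
  rw [← h1, ← Real.norm_eq_abs]
  refine norm_integral_le_of_norm_le ((integrableOn_Ioi_rpow_of_lt (by linarith) one_pos).const_mul M) ?_
  filter_upwards [self_mem_ae_restrict measurableSet_Ioi] with t ht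
  have ht0 : (0 : ℝ) < t := lt_trans one_pos ht
  rw [Real.norm_eq_abs, abs_mul, abs_of_pos (Real.rpow_pos_of_pos ht0 _)]
  exact mul_le_mul_of_nonneg_right (hM t) (Real.rpow_pos_of_pos ht0 _).le

theorem setIntegral_fracLaplacian_eq {u : ℝ → ℝ} (hu : Continuous u) {M : ℝ} (hM : ∀ z, |u z| ≤ M)
    {s : ℝ} (hs : 0 < s) (x : ℝ) {ν : ℝ} (hν : 0 < ν) :
    ∫ y in {y : ℝ | ν ≤ |x - y|}, (u x - u y) / |x - y| ^ (1 + 2 * s) =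
      -∫ t in Ioi ν, secondDiff u x t * t ^ (-(1 + 2 * s)) := by
  have hb : ∀ y, |u x - u y| ≤ 2 * M := fun y => by
    have := abs_sub (u x) (u y)
    linarith [hM x, hM y]
  have e₁ : ∀ t ∈ Ioi ν, (u x - u (x + t)) / |x - (x + t)| ^ (1 + 2 * s) =
      (u x - u (x + t)) * t ^ (-(1 + 2 * s)) := fun t ht => by
    have ht0 : 0 < t := hν.trans ht
    rw [show x - (x + t) = -t by ring, abs_neg, abs_of_pos ht0, Real.rpow_neg ht0.le, div_eq_mul_inv]
  have e₂ : ∀ t ∈ Ioi ν, (u x - u (x - t)) / |x - (x - t)| ^ (1 + 2 * s) =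
      (u x - u (x - t)) * t ^ (-(1 + 2 * s)) := fun t ht => by
    have ht0 : 0 < t := hν.trans ht
    rw [show x - (x - t) = t by ring, abs_of_pos ht0, Real.rpow_neg ht0.le, div_eq_mul_inv]
  rw [setIntegral_le_abs_sub (g := fun y => (u x - u y) / |x - y| ^ (1 + 2 * s)) hν, ← integral_neg]
  · refine setIntegral_congr_fun measurableSet_Ioi fun t ht => ?_
    simp only [e₁ t ht, e₂ t ht, secondDiff]
    ring
  · refine (integrableOn_Ioi_bdd_mul_rpow (g := fun t => u x - u (x + t)) (by fun_prop)
      (fun t => hb _) (by linarith) hν).congr_fun (fun t ht => (e₁ t ht).symm) measurableSet_Ioi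
  · refine (integrableOn_Ioi_bdd_mul_rpow (g := fun t => u x - u (x - t)) (by fun_prop)
      (fun t => hb _) (by linarith) hν).congr_fun (fun t ht => (e₂ t ht).symm) measurableSet_Ioi

theorem fracConst_one_pos {s : ℝ} (h0 : 0 < s) (h1 : s < 1) : 0 < fracConst 1 s := by
  unfold fracConst
  have := Real.Gamma_pos_of_pos (show 0 < 1 - s by linarith)
  have := Real.Gamma_pos_of_pos (show 0 < (((1 : ℕ) : ℝ) + 2 * s) / 2 by push_cast; linarith)
  have := Real.pi_pos
  positivity

/-- A bound for the fractional Laplacian of a bounded function controls the truncated integrals of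
the singular second differences near the origin. -/
theorem eventually_abs_integral_secondDiff_le {u : ℝ → ℝ} (hu : Continuous u) {M : ℝ}
    (hM : ∀ z, |u z| ≤ M) {s : ℝ} (h0 : 0 < s) (h1 : s < 1) {x a A : ℝ}
    (h : HasFracLaplacianAt s u x a) (ha : |a| < A) :
    ∀ᶠ ν in 𝓝[>] (0 : ℝ), |∫ t in ν..1, secondDiff u x t * t ^ (-(1 + 2 * s))| ≤
      A / fracConst 1 s + 2 * M / s := by
  have hγ := fracConst_one_pos h0 h1
  have hev := (h.abs.eventually (gt_mem_nhds ha))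
  filter_upwards [hev, self_mem_nhdsWithin, Ioo_mem_nhdsGT one_pos] with ν hν hν0 hν1
  have hν0 : 0 < ν := hν0
  rw [setIntegral_fracLaplacian_eq hu hM h0 x hν0, abs_mul, abs_neg, abs_of_pos hγ, mul_comm,
    ← lt_div_iff₀ hγ] at hν
  have hc : Continuous (secondDiff u x) := by unfold secondDiff; fun_prop
  have hb : ∀ t, |secondDiff u x t| ≤ 4 * M := fun t => by
    unfold secondDiff
    have a1 := abs_le.1 (hM (x + t))
    have a2 := abs_le.1 (hM (x - t))
    have a3 := abs_le.1 (hM x)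
    rw [abs_le]; constructor <;> linarith
  have hp : 1 < 1 + 2 * s := by linarith
  -- The integral over `(ν, 1]` is the full truncated integral, controlled by `A`, minus the tail
  -- beyond `1`, where second differences are at most `4M`.
  have hsub := intervalIntegral.integral_Ioi_sub_Ioi
    (integrableOn_Ioi_bdd_mul_rpow hc hb hp hν0) hν1.2.le
  rw [← hsub]
  have := abs_setIntegral_Ioi_bdd_mul_rpow_le hb hp
  have e : 4 * M / (1 + 2 * s - 1) = 2 * M / s := by field_simp; ring
  rw [e] at this
  exact (abs_sub _ _).trans (by linarith)

/-! ### The near potential and its derivative, by two integrations by parts. -/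

theorem intervalIntegrable_mul_rpow_neg {g : ℝ → ℝ} (hg : Continuous g) {a : ℝ} (ha : a < 1)
    (b c : ℝ) : IntervalIntegrable (fun t => g t * t ^ (-a)) volume b c :=
  (intervalIntegral.intervalIntegrable_rpow' (by linarith)).continuousOn_mul hg.continuousOn

/-- Symmetrised convolution of `f` with the singular kernel `|t|^{-a}` cut off at distance one. -/
noncomputable def nearPotential (a : ℝ) (f : ℝ → ℝ) (z : ℝ) : ℝ :=
  ∫ t in (0 : ℝ)..1, (f (z + t) + f (z - t)) * t ^ (-a)

theorem hasDerivAt_nearPotential {f : ℝ → ℝ} (hf : ContDiff ℝ 1 f) {a : ℝ} (ha : a < 1) (z : ℝ) :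
    HasDerivAt (nearPotential a f) (nearPotential a (deriv f) z) z := by
  have hc : Continuous f := hf.continuous
  have hc' : Continuous (deriv f) := hf.continuous_deriv le_rfl
  -- Radius `2` covers `x ± t` for `|x - z| < 1` and `t ≤ 1`.
  obtain ⟨B, hB⟩ := (isCompact_Icc (a := z - 2) (b := z + 2)).exists_bound_of_continuousOn
    hc'.continuousOn
  refine (intervalIntegral.hasDerivAt_integral_of_dominated_loc_of_deriv_le
    (F := fun x t => (f (x + t) + f (x - t)) * t ^ (-a))
    (F' := fun x t => (deriv f (x + t) + deriv f (x - t)) * t ^ (-a))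
    (bound := fun t => (2 * B) * t ^ (-a)) (Metric.ball_mem_nhds z one_pos) ?_ ?_ ?_ ?_ ?_ ?_).2
  · exact Eventually.of_forall fun x =>
      (intervalIntegrable_mul_rpow_neg (g := fun t => f (x + t) + f (x - t)) (by fun_prop) ha
        0 1).aestronglyMeasurable_restrict_uIoc
  · exact intervalIntegrable_mul_rpow_neg (g := fun t => f (z + t) + f (z - t)) (by fun_prop) ha 0 1
  · exact (intervalIntegrable_mul_rpow_neg (g := fun t => deriv f (z + t) + deriv f (z - t))
      (by fun_prop) ha 0 1).aestronglyMeasurable_restrict_uIoc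
  · refine ae_of_all _ fun t ht x hx => ?_
    rw [uIoc_of_le zero_le_one] at ht
    rw [Metric.mem_ball, Real.dist_eq, abs_lt] at hx
    rw [norm_mul, Real.norm_of_nonneg (Real.rpow_nonneg ht.1.le _)]
    refine mul_le_mul_of_nonneg_right ?_ (Real.rpow_nonneg ht.1.le _)
    refine (norm_add_le _ _).trans ?_
    have h1 := hB (x + t) ⟨by linarith [ht.1], by linarith [ht.2]⟩
    have h2 := hB (x - t) ⟨by linarith [ht.2], by linarith [ht.1]⟩
    linarith
  · exact intervalIntegrable_mul_rpow_neg continuous_const ha 0 1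
  · refine ae_of_all _ fun t ht x hx => HasDerivAt.mul_const (HasDerivAt.add ?_ ?_) _
    · exact ((hf.differentiable one_ne_zero (x + t)).hasDerivAt).comp_add_const x t
    · exact ((hf.differentiable one_ne_zero (x - t)).hasDerivAt).comp_sub_const x t

theorem hasDerivAt_secondDiff {u : ℝ → ℝ} (hu : Differentiable ℝ u) (x t : ℝ) :
    HasDerivAt (secondDiff u x) (deriv u (x + t) - deriv u (x - t)) t := by
  have h1 := ((hu (x + t)).hasDerivAt).comp_const_add x t
  have h2 := ((hu (x - t)).hasDerivAt).comp_const_sub x t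
  exact ((h1.add h2).sub_const (2 * u x)).congr_deriv (by ring)

/-- Antiderivative used to integrate the second derivative twice by parts against `t^{1-2s}`. -/
noncomputable def boundaryTerm (s : ℝ) (u : ℝ → ℝ) (x t : ℝ) : ℝ :=
  (deriv u (x + t) - deriv u (x - t)) * t ^ (-(2 * s - 1)) +
    (2 * s - 1) * (secondDiff u x t * t ^ (-(2 * s)))

/-- The coefficient `2s - 1` of the second summand is chosen so that the two terms in `t^{-2s}` with
first differences of `u'` cancel. -/
theorem hasDerivAt_boundaryTerm {u : ℝ → ℝ} (hu : ContDiff ℝ 2 u) (s x : ℝ) {t : ℝ} (ht : 0 < t) :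
    HasDerivAt (boundaryTerm s u x)
      ((deriv (deriv u) (x + t) + deriv (deriv u) (x - t)) * t ^ (-(2 * s - 1)) -
        2 * s * (2 * s - 1) * (secondDiff u x t * t ^ (-(1 + 2 * s)))) t := by
  have hu1 : Differentiable ℝ u := hu.differentiable two_ne_zero
  have hu2 : Differentiable ℝ (deriv u) :=
    (ContDiff.deriv' (n := 1) (by simpa [one_add_one_eq_two] using hu)).differentiable one_ne_zero
  have h1 := ((hu2 (x + t)).hasDerivAt).comp_const_add x t
  have h2 := ((hu2 (x - t)).hasDerivAt).comp_const_sub x t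
  have p1 := Real.hasDerivAt_rpow_const (x := t) (p := -(2 * s - 1)) (Or.inl ht.ne')
  have p2 := Real.hasDerivAt_rpow_const (x := t) (p := -(2 * s)) (Or.inl ht.ne')
  refine (((h1.sub h2).mul p1).add
    (((hasDerivAt_secondDiff hu1 x t).mul p2).const_mul (2 * s - 1))).congr_deriv ?_
  rw [show -(2 * s - 1) - 1 = -(2 * s) by ring, show -(2 * s) - 1 = -(1 + 2 * s) by ring]
  simp only [Pi.sub_apply]
  ring

theorem integral_deriv_deriv_eq {u : ℝ → ℝ} (hu : ContDiff ℝ 2 u) (s x : ℝ) {ν : ℝ} (hν : 0 < ν)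
    (hν1 : ν ≤ 1) :
    ∫ t in ν..1, (deriv (deriv u) (x + t) + deriv (deriv u) (x - t)) * t ^ (-(2 * s - 1)) =
      boundaryTerm s u x 1 - boundaryTerm s u x ν +
        2 * s * (2 * s - 1) * ∫ t in ν..1, secondDiff u x t * t ^ (-(1 + 2 * s)) := by
  have hc0 : Continuous u := hu.continuous
  have hc2 : Continuous (deriv (deriv u)) :=
    (ContDiff.deriv' (n := 1) (by simpa [one_add_one_eq_two] using hu)).continuous_deriv le_rfl
  have hr : ∀ r : ℝ, ContinuousOn (fun t : ℝ => t ^ r) (uIcc ν 1) := fun r t ht => by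
    rw [uIcc_of_le hν1] at ht
    exact (Real.continuousAt_rpow_const t r (Or.inl (hν.trans_le ht.1).ne')).continuousWithinAt
  have i1 : IntervalIntegrable (fun t => (deriv (deriv u) (x + t) + deriv (deriv u) (x - t)) *
      t ^ (-(2 * s - 1))) volume ν 1 :=
    (ContinuousOn.mul (Continuous.continuousOn (by fun_prop)) (hr _)).intervalIntegrable
  have i2 : IntervalIntegrable (fun t => 2 * s * (2 * s - 1) *
      (secondDiff u x t * t ^ (-(1 + 2 * s)))) volume ν 1 := by
    refine ((ContinuousOn.mul (Continuous.continuousOn ?_) (hr _)).const_smul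
      (2 * s * (2 * s - 1))).intervalIntegrable
    unfold secondDiff; fun_prop
  have := intervalIntegral.integral_eq_sub_of_hasDerivAt (a := ν) (b := 1)
    (f := boundaryTerm s u x) (fun t ht => by
      rw [uIcc_of_le hν1] at ht
      exact hasDerivAt_boundaryTerm hu s x (hν.trans_le ht.1)) (i1.sub i2)
  rw [intervalIntegral.integral_sub i1 i2, intervalIntegral.integral_const_mul] at this
  linarith

/-- A local bound on `u''` makes the difference of `u'` of order `t` and the second difference of
order `t²`, so both summands are `O(t^{2-2s})`, and `s < 1`. -/
theorem tendsto_boundaryTerm {u : ℝ → ℝ} (hu : ContDiff ℝ 2 u) {s : ℝ} (h0 : 1 / 2 < s) (h1 : s < 1)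
    (x : ℝ) : Tendsto (boundaryTerm s u x) (𝓝[>] 0) (𝓝 0) := by
  have hu1 : Differentiable ℝ u := hu.differentiable two_ne_zero
  have hu2' : ContDiff ℝ 1 (deriv u) :=
    ContDiff.deriv' (n := 1) (by simpa [one_add_one_eq_two] using hu)
  have hu2 : Differentiable ℝ (deriv u) := hu2'.differentiable one_ne_zero
  obtain ⟨B, hB⟩ := (isCompact_Icc (a := x - 1) (b := x + 1)).exists_bound_of_continuousOn
    (hu2'.continuous_deriv le_rfl).continuousOn
  have hB0 : 0 ≤ B := (norm_nonneg _).trans (hB x ⟨by linarith, by linarith⟩)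
  have b1 : ∀ t ∈ Icc (0 : ℝ) 1, |deriv u (x + t) - deriv u (x - t)| ≤ 2 * B * t := by
    intro t ht
    have := Convex.norm_image_sub_le_of_norm_deriv_le (f := deriv u) (s := Icc (x - 1) (x + 1))
      (C := B) (fun y _ => hu2 y) hB (convex_Icc _ _) (x := x - t) (y := x + t)
      ⟨by linarith [ht.2], by linarith [ht.1]⟩ ⟨by linarith [ht.1], by linarith [ht.2]⟩
    rw [Real.norm_eq_abs, Real.norm_eq_abs, show x + t - (x - t) = 2 * t by ring,
      abs_of_nonneg (a := 2 * t) (by linarith [ht.1])] at this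
    linarith
  have b2 : ∀ t ∈ Icc (0 : ℝ) 1, |secondDiff u x t| ≤ 2 * B * t * t := by
    intro t ht
    have := Convex.norm_image_sub_le_of_norm_deriv_le (f := secondDiff u x) (s := Icc 0 t)
      (C := 2 * B * t) (fun y _ => (hasDerivAt_secondDiff hu1 x y).differentiableAt)
      (fun y hy => by
        rw [(hasDerivAt_secondDiff hu1 x y).deriv]
        refine (b1 y ⟨hy.1, hy.2.trans ht.2⟩).trans ?_
        have := hy.2
        gcongr) (convex_Icc _ _) (x := 0) (y := t) ⟨le_rfl, ht.1⟩ ⟨ht.1, le_rfl⟩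
    have e : secondDiff u x 0 = 0 := by simp [secondDiff]; ring
    rwa [e, sub_zero, sub_zero, Real.norm_eq_abs, Real.norm_eq_abs, abs_of_nonneg ht.1] at this
  have hlim : Tendsto (fun t : ℝ => 4 * B * s * t ^ (2 - 2 * s)) (𝓝[>] 0) (𝓝 0) := by
    have : ContinuousAt (fun t : ℝ => 4 * B * s * t ^ (2 - 2 * s)) 0 :=
      (Real.continuousAt_rpow_const 0 _ (Or.inr (by linarith))).const_mul _
    have := this.tendsto.mono_left (nhdsWithin_le_nhds (s := Ioi 0))
    rwa [Real.zero_rpow (by linarith), mul_zero] at this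
  refine squeeze_zero_norm' ?_ hlim
  filter_upwards [Ioo_mem_nhdsGT one_pos] with t ht
  have ht' : t ∈ Icc (0 : ℝ) 1 := ⟨ht.1.le, ht.2.le⟩
  have r1 : t * t ^ (-(2 * s - 1)) = t ^ (2 - 2 * s) := by
    rw [← Real.rpow_one_add' ht.1.le (by linarith)]; congr 1; ring
  have r2 : t * (t * t ^ (-(2 * s))) = t ^ (2 - 2 * s) := by
    rw [← r1, ← Real.rpow_one_add' ht.1.le (by linarith)]; congr 2; ring
  have q1 := Real.rpow_nonneg ht.1.le (-(2 * s - 1))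
  have q2 := Real.rpow_nonneg ht.1.le (-(2 * s))
  calc ‖boundaryTerm s u x t‖ ≤ 2 * B * t * t ^ (-(2 * s - 1)) +
        (2 * s - 1) * (2 * B * t * t * t ^ (-(2 * s))) := by
        refine (norm_add_le _ _).trans (add_le_add ?_ ?_)
        · rw [norm_mul, Real.norm_eq_abs, Real.norm_of_nonneg q1]
          exact mul_le_mul_of_nonneg_right (b1 t ht') q1
        · rw [norm_mul, norm_mul, Real.norm_of_nonneg (show 0 ≤ 2 * s - 1 by linarith),
            Real.norm_of_nonneg q2, Real.norm_eq_abs]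
          exact mul_le_mul_of_nonneg_left (mul_le_mul_of_nonneg_right (b2 t ht') q2) (by linarith)
    _ = 2 * B * (t * t ^ (-(2 * s - 1))) + (2 * s - 1) * (2 * B * (t * (t * t ^ (-(2 * s))))) := by
        ring
    _ = 4 * B * s * t ^ (2 - 2 * s) := by rw [r1, r2]; ring

/-- If `u` and its fractional Laplacian are bounded, the derivative of the near potential of `u'`
is a bounded perturbation of `u'(x+1) - u'(x-1)`. -/
theorem abs_nearPotential_deriv_deriv_sub_le {u : ℝ → ℝ} (hu : ContDiff ℝ 2 u) {M : ℝ}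
    (hM : ∀ z, |u z| ≤ M) {s : ℝ} (h0 : 1 / 2 < s) (h1 : s < 1) {x a A : ℝ}
    (h : HasFracLaplacianAt s u x a) (ha : |a| < A) :
    |nearPotential (2 * s - 1) (deriv (deriv u)) x - (deriv u (x + 1) - deriv u (x - 1))| ≤
      4 * M + 4 * (A / fracConst 1 s + 2 * M / s) := by
  have hc2 : Continuous (deriv (deriv u)) :=
    (ContDiff.deriv' (n := 1) (by simpa [one_add_one_eq_two] using hu)).continuous_deriv le_rfl
  set K := A / fracConst 1 s + 2 * M / s with hK
  set D := deriv u (x + 1) - deriv u (x - 1) with hD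
  have hint : IntervalIntegrable (fun t => (deriv (deriv u) (x + t) + deriv (deriv u) (x - t)) *
      t ^ (-(2 * s - 1))) volume 0 1 := intervalIntegrable_mul_rpow_neg
    (g := fun t => deriv (deriv u) (x + t) + deriv (deriv u) (x - t)) (by fun_prop) (by linarith) 0 1
  have hlim : Tendsto (fun ν : ℝ => ∫ t in ν..1,
      (deriv (deriv u) (x + t) + deriv (deriv u) (x - t)) * t ^ (-(2 * s - 1))) (𝓝[>] 0)
      (𝓝 (nearPotential (2 * s - 1) (deriv (deriv u)) x)) := by
    have hcont := intervalIntegral.continuousOn_primitive_interval_left (a := 0) (b := 1)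
      (by rw [uIcc_of_le zero_le_one]; exact (intervalIntegrable_iff_integrableOn_Icc_of_le zero_le_one).1 hint)
    rw [uIcc_of_le zero_le_one] at hcont
    refine (hcont 0 ⟨le_rfl, zero_le_one⟩).tendsto.mono_left ?_
    rw [← nhdsWithin_Ioo_eq_nhdsGT (zero_lt_one' ℝ)]
    exact nhdsWithin_mono _ Ioo_subset_Icc_self
  have hlim2 : Tendsto (fun ν : ℝ => |(∫ t in ν..1,
      (deriv (deriv u) (x + t) + deriv (deriv u) (x - t)) * t ^ (-(2 * s - 1))) - D +
      boundaryTerm s u x ν|) (𝓝[>] 0)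
      (𝓝 |nearPotential (2 * s - 1) (deriv (deriv u)) x - D|) := by
    have := ((hlim.sub_const D).add (tendsto_boundaryTerm hu h0 h1 x)).abs
    rwa [add_zero] at this
  refine le_of_tendsto hlim2 ?_
  filter_upwards [eventually_abs_integral_secondDiff_le hu.continuous hM (by linarith) h1 h ha,
    Ioo_mem_nhdsGT one_pos] with ν hν hν1
  rw [integral_deriv_deriv_eq hu s x hν1.1 hν1.2.le]
  have e : boundaryTerm s u x 1 = D + (2 * s - 1) * secondDiff u x 1 := by
    simp [boundaryTerm, hD]
  rw [e]
  set J := ∫ t in ν..1, secondDiff u x t * t ^ (-(1 + 2 * s))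
  -- The uncontrolled quantity `D` cancels; what remains involves only `u` and the truncated
  -- fractional Laplacian.
  rw [show D + (2 * s - 1) * secondDiff u x 1 - boundaryTerm s u x ν + 2 * s * (2 * s - 1) * J - D +
    boundaryTerm s u x ν = (2 * s - 1) * secondDiff u x 1 + (2 * s * (2 * s - 1)) * J by ring]
  have hsd : |secondDiff u x 1| ≤ 4 * M := by
    unfold secondDiff
    have a1 := abs_le.1 (hM (x + 1))
    have a2 := abs_le.1 (hM (x - 1))
    have a3 := abs_le.1 (hM x)
    rw [abs_le]; constructor <;> linarith
  refine (abs_add_le _ _).trans (add_le_add ?_ ?_)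
  · rw [abs_mul, abs_of_nonneg (show 0 ≤ 2 * s - 1 by linarith)]
    calc (2 * s - 1) * |secondDiff u x 1| ≤ 1 * |secondDiff u x 1| := by gcongr; linarith
      _ ≤ _ := by linarith
  · have : 0 ≤ 2 * s * (2 * s - 1) := mul_nonneg (by linarith) (by linarith)
    rw [abs_mul, abs_of_nonneg this]
    have : 2 * s * (2 * s - 1) ≤ 4 := by nlinarith
    have := abs_nonneg J
    gcongr

/-! ### Correlations with kernels, with values in `[0,∞]`. -/

/-- Cauchy–Schwarz for the factors `φ^{1/2}` and `φ^{1/2} k`; only the mass of `φ` enters, never its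
size. -/
theorem sq_lintegral_mul_le {φ k : ℝ → ℝ≥0∞} (hφ : Measurable φ) (hk : Measurable k) :
    (∫⁻ t, φ t * k t) ^ 2 ≤ (∫⁻ t, φ t) * ∫⁻ t, φ t * k t ^ 2 := by
  have h := ENNReal.lintegral_mul_le_Lp_mul_Lq (volume : Measure ℝ)
    (p := 2) (q := 2) (Real.HolderConjugate.two_two) (f := fun t => φ t ^ (1 / 2 : ℝ))
    (g := fun t => φ t ^ (1 / 2 : ℝ) * k t) (by fun_prop) (by fun_prop)
  have e0 : ∀ a : ℝ≥0∞, a ^ (1 / 2 : ℝ) * a ^ (1 / 2 : ℝ) = a := fun a => by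
    rw [← ENNReal.rpow_add_of_nonneg _ _ (by norm_num) (by norm_num)]; norm_num
  have e1 : ∀ a : ℝ≥0∞, (a ^ (1 / 2 : ℝ)) ^ (2 : ℝ) = a := fun a => by
    rw [← ENNReal.rpow_mul]; norm_num
  have e2 : ∀ a : ℝ≥0∞, (a ^ (1 / 2 : ℝ)) ^ 2 = a := fun a => by
    rw [sq, e0]
  simp only [Pi.mul_apply, ← mul_assoc, e0, ENNReal.mul_rpow_of_nonneg _ _ (zero_le_two (α := ℝ)),
    e1, ENNReal.rpow_two] at h
  calc _ ≤ _ := pow_le_pow_left' h 2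
    _ = _ := by rw [mul_pow, e2, e2]

/-- Correlation of a nonnegative density with a kernel. -/
noncomputable def lcorr (φ k : ℝ → ℝ≥0∞) (z : ℝ) : ℝ≥0∞ := ∫⁻ t, φ (z + t) * k t

theorem lcorr_eq (φ k : ℝ → ℝ≥0∞) (z : ℝ) : lcorr φ k z = ∫⁻ y, φ y * k (y - z) := by
  unfold lcorr
  rw [← lintegral_add_left_eq_self (fun y => φ y * k (y - z)) z]
  simp

theorem measurable_lcorr {φ k : ℝ → ℝ≥0∞} (hφ : Measurable φ) (hk : Measurable k) :
    Measurable (lcorr φ k) := by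
  unfold lcorr
  exact Measurable.lintegral_prod_right' (f := fun p : ℝ × ℝ => φ (p.1 + p.2) * k p.2) (by fun_prop)

theorem lcorr_mono {φ k k' : ℝ → ℝ≥0∞} (h : ∀ t, k t ≤ k' t) (z : ℝ) :
    lcorr φ k z ≤ lcorr φ k' z :=
  lintegral_mono fun t => mul_le_mul_right (h t) _

theorem lcorr_add {φ k k' : ℝ → ℝ≥0∞} (hφ : Measurable φ) (hk : Measurable k) (z : ℝ) :
    lcorr φ (fun t => k t + k' t) z = lcorr φ k z + lcorr φ k' z := by
  unfold lcorr
  simp only [mul_add]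
  exact lintegral_add_left (by fun_prop) _

theorem lcorr_sq_le {φ k : ℝ → ℝ≥0∞} (hφ : Measurable φ) (hk : Measurable k) (z : ℝ) :
    lcorr φ k z ^ 2 ≤ (∫⁻ t, φ t) * lcorr φ (fun t => k t ^ 2) z := by
  rw [← lintegral_add_left_eq_self φ z]
  exact sq_lintegral_mul_le (φ := fun t => φ (z + t)) (by fun_prop) hk

theorem lcorr_le_of_le {φ k : ℝ → ℝ≥0∞} (hφ : Measurable φ) {C : ℝ≥0∞} (h : ∀ t, k t ≤ C) (z : ℝ) :
    lcorr φ k z ≤ (∫⁻ t, φ t) * C := by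
  rw [← lintegral_add_left_eq_self φ z, ← lintegral_mul_const _ (by fun_prop)]
  exact lintegral_mono fun t => mul_le_mul_right (h t) _

theorem setLIntegral_lcorr_le {φ k : ℝ → ℝ≥0∞} (hφ : Measurable φ) (hk : Measurable k) {E : Set ℝ}
    {C : ℝ≥0∞} (h : ∀ y, ∫⁻ z in E, k (y - z) ≤ C) :
    ∫⁻ z in E, lcorr φ k z ≤ (∫⁻ t, φ t) * C := by
  simp only [lcorr_eq]
  rw [lintegral_lintegral_swap (by fun_prop), ← lintegral_mul_const _ hφ]
  refine lintegral_mono fun y => ?_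
  rw [lintegral_const_mul _ (by fun_prop)]
  exact mul_le_mul_right (h y) _

theorem lintegral_lcorr_le {φ k : ℝ → ℝ≥0∞} (hφ : Measurable φ) (hk : Measurable k) :
    ∫⁻ z, lcorr φ k z ≤ (∫⁻ t, φ t) * ∫⁻ t, k t := by
  have := setLIntegral_lcorr_le hφ hk (E := univ) (C := ∫⁻ t, k t)
    (fun y => by rw [Measure.restrict_univ, lintegral_sub_left_eq_self])
  rwa [Measure.restrict_univ] at this

/-- The kernel `|t|^{-a}` restricted to a set. -/
noncomputable def kern (a : ℝ) (S : Set ℝ) : ℝ → ℝ≥0∞ :=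
  S.indicator fun t => ENNReal.ofReal (|t| ^ (-a))

theorem measurable_kern (a : ℝ) {S : Set ℝ} (hS : MeasurableSet S) : Measurable (kern a S) :=
  Measurable.indicator (by fun_prop) hS

theorem kern_le_add_compl (a : ℝ) (S T : Set ℝ) (t : ℝ) : kern a S t ≤ kern a T t + kern a Tᶜ t := by
  have : kern a T t + kern a Tᶜ t = ENNReal.ofReal (|t| ^ (-a)) := by
    unfold kern; rw [indicator_self_add_compl_apply]
  rw [this]
  exact indicator_le_self _ _ _

theorem lcorr_kern_eq (φ : ℝ → ℝ≥0∞) (a : ℝ) {S : Set ℝ} (hS : MeasurableSet S) (z : ℝ) :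
    lcorr φ (kern a S) z = ∫⁻ t in S, φ (z + t) * ENNReal.ofReal (|t| ^ (-a)) := by
  rw [← lintegral_indicator hS]
  unfold lcorr kern
  refine lintegral_congr fun t => ?_
  by_cases h : t ∈ S <;> simp [h]

theorem setLIntegral_Ioc_neg_one_one (g : ℝ → ℝ≥0∞) (hg : Measurable g) :
    ∫⁻ t in Ioc (-1 : ℝ) 1, g t = ∫⁻ t in Ioc (0 : ℝ) 1, (g t + g (-t)) := by
  rw [lintegral_add_left hg, ← Ioc_union_Ioc_eq_Ioc (b := (0 : ℝ)) (by norm_num) (by norm_num),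
    lintegral_union measurableSet_Ioc (Ioc_disjoint_Ioc_of_le le_rfl), add_comm]
  congr 1
  rw [Measure.restrict_congr_set (Ioo_ae_eq_Ioc (a := (-1 : ℝ)) (b := 0)).symm,
    Measure.restrict_congr_set (Ioo_ae_eq_Ioc (a := (0 : ℝ)) (b := 1)).symm,
    ← (Measure.measurePreserving_neg (volume : Measure ℝ)).setLIntegral_comp_preimage_emb
      (MeasurableEquiv.neg ℝ).measurableEmbedding]
  simp

theorem lcorr_kern_Ioc_eq {f : ℝ → ℝ} (hf : Continuous f) (hf0 : ∀ t, 0 ≤ f t) {a : ℝ} (ha : a < 1)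
    (z : ℝ) : lcorr (fun t => ENNReal.ofReal (f t)) (kern a (Ioc (-1) 1)) z =
      ENNReal.ofReal (nearPotential a f z) := by
  rw [lcorr_kern_eq _ _ measurableSet_Ioc, setLIntegral_Ioc_neg_one_one _ (by fun_prop),
    nearPotential, intervalIntegral.integral_of_le zero_le_one,
    ofReal_integral_eq_lintegral_ofReal]
  · refine setLIntegral_congr_fun measurableSet_Ioc fun t ht => ?_
    have := Real.rpow_nonneg ht.1.le (-a)
    simp only [abs_neg, abs_of_pos ht.1, ← sub_eq_add_neg]
    rw [← add_mul, ← ENNReal.ofReal_add (hf0 _) (hf0 _), ENNReal.ofReal_mul]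
    exact add_nonneg (hf0 _) (hf0 _)
  · exact (intervalIntegrable_mul_rpow_neg (g := fun t => f (z + t) + f (z - t)) (by fun_prop) ha
      0 1).1
  · filter_upwards [self_mem_ae_restrict measurableSet_Ioc] with t ht
    exact mul_nonneg (add_nonneg (hf0 _) (hf0 _)) (Real.rpow_nonneg ht.1.le _)

theorem lintegral_kern_Ioc_lt_top {a : ℝ} (ha : a < 1) : ∫⁻ t, kern a (Ioc (-1) 1) t < ∞ := by
  have h := lcorr_kern_Ioc_eq (f := fun _ => 1) continuous_const (fun _ => zero_le_one) ha 0
  simp only [lcorr, ENNReal.ofReal_one, one_mul] at h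
  rw [h]
  exact ENNReal.ofReal_lt_top

theorem kern_compl_le_one {a : ℝ} (ha : 0 ≤ a) (t : ℝ) : kern a (Ioc (-1) 1)ᶜ t ≤ 1 := by
  unfold kern
  by_cases h : t ∈ (Ioc (-1 : ℝ) 1)ᶜ
  · rw [indicator_of_mem h]
    rw [mem_compl_iff, mem_Ioc, not_and_or, not_lt, not_le] at h
    have : 1 ≤ |t| := by
      rcases h with h | h
      · rw [abs_of_nonpos (by linarith)]; linarith
      · rw [abs_of_nonneg (by linarith)]; linarith
    exact ENNReal.ofReal_le_one.2 (Real.rpow_le_one_of_one_le_of_nonpos this (by linarith))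
  · rw [indicator_of_notMem h]; exact zero_le_one

theorem eta_eq_toReal {s : ℝ} {w : ℝ → ℝ} (hw : ∀ t, 0 ≤ deriv w t)
    {L : ℝ} (hL : 0 ≤ L) (z : ℝ) : eta s w 1 L z =
      (lcorr (fun t => ENNReal.ofReal (deriv w t)) (kern (2 * s - 1) (Ioc (-L) L)) z).toReal := by
  have hr : rescale w 1 = w := by funext t; simp [rescale]
  rw [eta, hr, intervalIntegral.integral_of_le (by linarith), integral_eq_lintegral_of_nonneg_ae,
    lcorr_kern_eq _ _ measurableSet_Ioc]
  · congr 1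
    refine lintegral_congr fun t => ?_
    rw [← ENNReal.ofReal_mul (hw _), Real.rpow_neg (abs_nonneg t), div_eq_mul_inv]
  · exact ae_of_all _ fun t => div_nonneg (hw _) (Real.rpow_nonneg (abs_nonneg _) _)
  · exact Measurable.aestronglyMeasurable (by fun_prop)

/-! ### Mass of `w'` and the sup bound for the near potential. -/

namespace IsOptimalProfile

variable {s : ℝ} {W w : ℝ → ℝ}

theorem abs_le_one (hw : IsOptimalProfile s W w) (z : ℝ) : |w z| ≤ 1 :=
  abs_le.2 ⟨(hw.mem_Ioo z).1.le, (hw.mem_Ioo z).2.le⟩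

theorem contDiff_deriv (hw : IsOptimalProfile s W w) : ContDiff ℝ 1 (deriv w) :=
  ContDiff.deriv' (n := 1) (by simpa [one_add_one_eq_two] using hw.contDiff)

theorem continuous_deriv (hw : IsOptimalProfile s W w) : Continuous (deriv w) :=
  hw.contDiff_deriv.continuous

theorem differentiable (hw : IsOptimalProfile s W w) : Differentiable ℝ w :=
  hw.contDiff.differentiable two_ne_zero

theorem deriv_nonneg (hw : IsOptimalProfile s W w) (z : ℝ) : 0 ≤ deriv w z :=
  hw.strictMono.monotone.deriv_nonneg

theorem integral_deriv (hw : IsOptimalProfile s W w) (a b : ℝ) :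
    ∫ t in a..b, deriv w t = w b - w a :=
  intervalIntegral.integral_deriv_eq_sub (fun t _ => hw.differentiable t)
    (hw.continuous_deriv.intervalIntegrable a b)

theorem integrable_deriv (hw : IsOptimalProfile s W w) : Integrable (deriv w) := by
  refine integrable_of_intervalIntegral_norm_bounded (ι := ℝ) (l := atTop) (a := fun i => -i)
    (b := fun i => i) 2 (fun i => (hw.continuous_deriv.integrableOn_Ioc))
    tendsto_neg_atTop_atBot tendsto_id ?_
  refine Eventually.of_forall fun i => ?_
  simp only [Real.norm_of_nonneg (hw.deriv_nonneg _), hw.integral_deriv]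
  linarith [(hw.mem_Ioo i).2, (hw.mem_Ioo (-i)).1]

theorem lintegral_deriv (hw : IsOptimalProfile s W w) :
    ∫⁻ t, ENNReal.ofReal (deriv w t) = 2 := by
  rw [← ofReal_integral_eq_lintegral_ofReal hw.integrable_deriv (ae_of_all _ hw.deriv_nonneg),
    integral_of_hasDerivAt_of_tendsto (fun t => (hw.differentiable t).hasDerivAt)
      hw.integrable_deriv hw.tendsto_atBot hw.tendsto_atTop]
  norm_num

theorem exists_nearPotential_le (hW : IsDoubleWell W) (hw : IsOptimalProfile s W w) (h0 : 1 / 2 < s)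
    (h1 : s < 1) : ∃ C : ℝ, ∀ z, nearPotential (2 * s - 1) (deriv w) z ≤ C := by
  obtain ⟨B, hB⟩ := (isCompact_Icc (a := (-1 : ℝ)) (b := 1)).exists_bound_of_continuousOn
    (hW.contDiff.continuous_deriv (by norm_num)).continuousOn
  set G := nearPotential (2 * s - 1) (deriv w)
  -- The bound of the by-parts estimate with `M = 1`; `B + 1` replaces `B` because a strict bound on
  -- the fractional Laplacian is required.
  set K := 4 * 1 + 4 * ((B + 1) / fracConst 1 s + 2 * 1 / s) with hK
  have hder : ∀ z, HasDerivAt (fun z => G z - (w (z + 1) - w (z - 1)))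
      (nearPotential (2 * s - 1) (deriv (deriv w)) z - (deriv w (z + 1) - deriv w (z - 1))) z :=
    fun z => (hasDerivAt_nearPotential hw.contDiff_deriv (by linarith) z).sub
      (((hw.differentiable (z + 1)).hasDerivAt.comp_add_const z 1).sub
        ((hw.differentiable (z - 1)).hasDerivAt.comp_sub_const z 1))
  -- The mean value inequality applies to `G z - (w (z + 1) - w (z - 1))`; removing the subtracted
  -- term costs at most `4`, since `|w| < 1`.
  have hlip : ∀ y z, G z ≤ G y + (K * |z - y| + 4) := fun y z => by
    have h := Convex.norm_image_sub_le_of_norm_hasDerivWithin_le (s := univ) (C := K)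
      (fun z _ => (hder z).hasDerivWithinAt) (fun z _ => by
        rw [Real.norm_eq_abs]
        refine abs_nearPotential_deriv_deriv_sub_le hw.contDiff hw.abs_le_one h0 h1 (hw.equation z) ?_
        rw [abs_neg]
        have := hB (w z) ⟨(hw.mem_Ioo z).1.le, (hw.mem_Ioo z).2.le⟩
        rw [Real.norm_eq_abs] at this
        linarith) convex_univ (mem_univ y) (mem_univ z)
    rw [Real.norm_eq_abs, Real.norm_eq_abs] at h
    have := (abs_le.1 h).2
    have a1 := hw.mem_Ioo (z + 1)
    have a2 := hw.mem_Ioo (z - 1)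
    have a3 := hw.mem_Ioo (y + 1)
    have a4 := hw.mem_Ioo (y - 1)
    linarith [a1.1, a1.2, a2.1, a2.2, a3.1, a3.2, a4.1, a4.2]
  have hK0 : 0 ≤ K := by
    have := fracConst_one_pos (show 0 < s by linarith) h1
    have : 0 ≤ B := (norm_nonneg _).trans (hB 0 (by norm_num))
    have : 0 < s := by linarith
    positivity
  set I := ∫⁻ t, kern (2 * s - 1) (Ioc (-1) 1) t with hI
  have hItop : I < ∞ := lintegral_kern_Ioc_lt_top (by linarith)
  have hint : ∫⁻ z, ENNReal.ofReal (G z) ≤ 2 * I := by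
    have := lintegral_lcorr_le (φ := fun t => ENNReal.ofReal (deriv w t))
      (k := kern (2 * s - 1) (Ioc (-1) 1)) (by fun_prop) (measurable_kern _ measurableSet_Ioc)
    rw [hw.lintegral_deriv] at this
    simpa only [lcorr_kern_Ioc_eq hw.continuous_deriv hw.deriv_nonneg
      (show 2 * s - 1 < 1 by linarith)] using this
  refine ⟨(2 * I).toReal + (K + 4), fun z => ?_⟩
  have hG0 : ∀ z, 0 ≤ G z := fun z =>
    intervalIntegral.integral_nonneg zero_le_one fun t ht =>
      mul_nonneg (add_nonneg (hw.deriv_nonneg _) (hw.deriv_nonneg _)) (Real.rpow_nonneg ht.1 _)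
  -- Averaging the near-Lipschitz bound over a unit interval compares the value at `z` with the L¹
  -- norm.
  have key : ENNReal.ofReal (G z) ≤ 2 * I + ENNReal.ofReal (K + 4) := by
    calc ENNReal.ofReal (G z) = ∫⁻ _ in Icc z (z + 1), ENNReal.ofReal (G z) := by simp
      _ ≤ ∫⁻ y in Icc z (z + 1), (ENNReal.ofReal (G y) + ENNReal.ofReal (K + 4)) := by
        refine setLIntegral_mono' measurableSet_Icc fun y hy => ?_
        rw [← ENNReal.ofReal_add (hG0 y) (by linarith)]
        refine ENNReal.ofReal_le_ofReal ((hlip y z).trans ?_)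
        have : |z - y| ≤ 1 := abs_le.2 ⟨by linarith [hy.2], by linarith [hy.1]⟩
        nlinarith
      _ = (∫⁻ y in Icc z (z + 1), ENNReal.ofReal (G y)) + ENNReal.ofReal (K + 4) := by
        rw [lintegral_add_right _ measurable_const]; simp
      _ ≤ _ := by gcongr; exact (setLIntegral_le_lintegral _ _).trans hint
  have htop : 2 * I ≠ ∞ := ENNReal.mul_ne_top (by simp) hItop.ne
  have := ENNReal.toReal_mono (by finiteness) key
  rwa [ENNReal.toReal_add htop (by simp), ENNReal.toReal_ofReal (hG0 z),
    ENNReal.toReal_ofReal (by linarith)] at this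

end IsOptimalProfile

/-! ### Squared far kernels. -/

theorem lintegral_compl_Ioc_abs_le (g : ℝ → ℝ≥0∞) :
    ∫⁻ t in (Ioc (-1 : ℝ) 1)ᶜ, g |t| ≤ 2 * ∫⁻ t in Ici (1 : ℝ), g t := by
  have hs : (Ioc (-1 : ℝ) 1)ᶜ ⊆ Iic (-1) ∪ Ici 1 := fun t ht => by
    rw [mem_compl_iff, mem_Ioc, not_and_or, not_lt, not_le] at ht
    exact ht.imp id le_of_lt
  refine (lintegral_mono_set hs).trans ((lintegral_union_le _ _ _).trans_eq ?_)
  have h1 : ∫⁻ t in Ici (1 : ℝ), g |t| = ∫⁻ t in Ici (1 : ℝ), g t :=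
    setLIntegral_congr_fun measurableSet_Ici fun t ht => by
      simp only [abs_of_pos (lt_of_lt_of_le one_pos (mem_Ici.1 ht))]
  have h2 : ∫⁻ t in Iic (-1 : ℝ), g |t| = ∫⁻ t in Ici (1 : ℝ), g |t| := by
    rw [← (Measure.measurePreserving_neg (volume : Measure ℝ)).setLIntegral_comp_preimage_emb
      (MeasurableEquiv.neg ℝ).measurableEmbedding]
    simp
  rw [h2, h1, two_mul]

theorem kern_sq (a : ℝ) (S : Set ℝ) (t : ℝ) :
    kern a S t ^ 2 = S.indicator (fun t => ENNReal.ofReal (|t| ^ (-(2 * a)))) t := by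
  unfold kern
  by_cases h : t ∈ S
  · rw [indicator_of_mem h, indicator_of_mem h, ← ENNReal.ofReal_pow (Real.rpow_nonneg (abs_nonneg _) _),
      ← Real.rpow_mul_natCast (abs_nonneg _)]
    congr 2; push_cast; ring
  · simp [h]

theorem lintegral_kern_compl_sq_lt_top {a : ℝ} (ha : 1 / 2 < a) :
    ∫⁻ t, kern a (Ioc (-1) 1)ᶜ t ^ 2 < ∞ := by
  simp only [kern_sq]
  rw [lintegral_indicator measurableSet_Ioc.compl]
  refine (lintegral_compl_Ioc_abs_le fun t => ENNReal.ofReal (t ^ (-(2 * a)))).trans_lt ?_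
  refine ENNReal.mul_lt_top (by simp) ?_
  rw [← Measure.restrict_congr_set Ioi_ae_eq_Ici]
  exact (integrableOn_Ioi_rpow_of_lt (a := -(2 * a)) (by linarith) one_pos).lintegral_lt_top

/-- Distances between `1` and `R` contribute at most `2 log R`. Beyond `R` the squared kernel is at
most `1/R`, on a window of length `2R`. The bound is thus uniform in the centre `y`. -/
theorem setLIntegral_kern_half_compl_sq_le {R : ℝ} (hR : 1 ≤ R) (y : ℝ) :
    ∫⁻ z in Ioc (-R) R, kern (1 / 2) (Ioc (-1) 1)ᶜ (y - z) ^ 2 ≤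
      ENNReal.ofReal (2 * Real.log R + 2) := by
  have hR0 : 0 < R := by linarith
  set g : ℝ → ℝ≥0∞ := (Iic R).indicator fun t => ENNReal.ofReal t⁻¹ with hg
  have hgm : Measurable g := Measurable.indicator (by fun_prop) measurableSet_Iic
  have hpt : ∀ t, kern (1 / 2) (Ioc (-1) 1)ᶜ t ^ 2 ≤
      ((Ioc (-1 : ℝ) 1)ᶜ.indicator (fun t => g |t|) t) + ENNReal.ofReal R⁻¹ := fun t => by
    rw [kern_sq]
    by_cases h : t ∈ (Ioc (-1 : ℝ) 1)ᶜ
    · rw [indicator_of_mem h, indicator_of_mem h]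
      norm_num [Real.rpow_neg_one]
      by_cases h' : |t| ≤ R
      · rw [hg, indicator_of_mem (mem_Iic.2 h')]
        exact le_self_add
      · rw [not_le] at h'
        refine le_add_left (ENNReal.ofReal_le_ofReal ?_)
        gcongr
    · rw [indicator_of_notMem h]; exact zero_le
  have h1 : ∫⁻ z in Ioc (-R) R, (Ioc (-1 : ℝ) 1)ᶜ.indicator (fun t => g |t|) (y - z) ≤
      ENNReal.ofReal (2 * Real.log R) := by
    refine (setLIntegral_le_lintegral _ _).trans ?_
    rw [lintegral_sub_left_eq_self, lintegral_indicator measurableSet_Ioc.compl]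
    refine (lintegral_compl_Ioc_abs_le g).trans_eq ?_
    rw [hg, lintegral_indicator measurableSet_Iic, Measure.restrict_restrict measurableSet_Iic,
      Iic_inter_Ici, Measure.restrict_congr_set Ioc_ae_eq_Icc.symm,
      ← ofReal_integral_eq_lintegral_ofReal, ← intervalIntegral.integral_of_le hR,
      integral_inv_of_pos one_pos hR0, div_one, ENNReal.ofReal_mul zero_le_two]
    · simp
    · have : IntervalIntegrable (fun t : ℝ => t⁻¹) volume 1 R :=
        intervalIntegral.intervalIntegrable_inv (fun t ht => by
          rw [uIcc_of_le hR] at ht; linarith [ht.1]) continuousOn_id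
      exact this.1
    · filter_upwards [self_mem_ae_restrict measurableSet_Ioc] with t ht
      exact inv_nonneg.2 (by linarith [ht.1])
  calc _ ≤ ∫⁻ z in Ioc (-R) R, ((Ioc (-1 : ℝ) 1)ᶜ.indicator (fun t => g |t|) (y - z) +
        ENNReal.ofReal R⁻¹) := lintegral_mono fun z => hpt _
    _ ≤ ENNReal.ofReal (2 * Real.log R) + ENNReal.ofReal 2 := by
      rw [lintegral_add_right _ measurable_const]
      refine add_le_add h1 (le_of_eq ?_)
      rw [setLIntegral_const, Real.volume_Ioc, ← ENNReal.ofReal_mul (by positivity)]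
      congr 1; field_simp; ring
    _ = _ := (ENNReal.ofReal_add (mul_nonneg zero_le_two (Real.log_nonneg hR)) zero_le_two).symm

/-! ### L² bounds for potentials and the limit for `s > 3/4`. -/

/-- Weighted Young inequality: the far part, in the role of `b`, keeps a coefficient close to `1`,
which the sharp constant `8` requires. -/
theorem add_sq_le_weighted {a b : ℝ≥0∞} (ha : a ≠ ∞) (hb : b ≠ ∞) {δ : ℝ} (hδ : 0 < δ) :
    (a + b) ^ 2 ≤ ENNReal.ofReal (1 + δ) * b ^ 2 + ENNReal.ofReal (1 + δ⁻¹) * a ^ 2 := by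
  have hδ' : 0 < δ⁻¹ := inv_pos.2 hδ
  rw [← ENNReal.ofReal_toReal ha, ← ENNReal.ofReal_toReal hb]
  have ha0 := a.toReal_nonneg
  have hb0 := b.toReal_nonneg
  generalize a.toReal = x at *
  generalize b.toReal = y at *
  rw [← ENNReal.ofReal_add ha0 hb0, ← ENNReal.ofReal_pow (by linarith), ← ENNReal.ofReal_pow ha0,
    ← ENNReal.ofReal_pow hb0, ← ENNReal.ofReal_mul (by linarith), ← ENNReal.ofReal_mul (by linarith),
    ← ENNReal.ofReal_add (by positivity) (by positivity)]
  refine ENNReal.ofReal_le_ofReal ?_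
  have : δ⁻¹ * (δ * y - x) ^ 2 = δ * y ^ 2 + δ⁻¹ * x ^ 2 - 2 * x * y := by field_simp; ring
  have : 0 ≤ δ⁻¹ * (δ * y - x) ^ 2 := by positivity
  nlinarith

/-- The potential `∫ w'(z+t) |t|^{1-2s} dt` restricted to `t ∈ S`, with values in `[0,∞]`. -/
noncomputable def potential (s : ℝ) (w : ℝ → ℝ) (S : Set ℝ) (z : ℝ) : ℝ≥0∞ :=
  lcorr (fun t => ENNReal.ofReal (deriv w t)) (kern (2 * s - 1) S) z

/-- The squared `L²` norm of the full potential `∫ w'(z+t) |t|^{1-2s} dt`. -/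
noncomputable def potentialMass (s : ℝ) (w : ℝ → ℝ) : ℝ := ∫ z, (potential s w univ z).toReal ^ 2

theorem measurable_potential (s : ℝ) (w : ℝ → ℝ) {S : Set ℝ} (hS : MeasurableSet S) :
    Measurable (potential s w S) :=
  measurable_lcorr (by fun_prop) (measurable_kern _ hS)

theorem potential_le_add_compl (s : ℝ) (w : ℝ → ℝ) (S : Set ℝ) {T : Set ℝ} (hT : MeasurableSet T)
    (z : ℝ) : potential s w S z ≤ potential s w T z + potential s w Tᶜ z := by
  unfold potential
  rw [← lcorr_add (by fun_prop) (measurable_kern _ hT)]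
  exact lcorr_mono (kern_le_add_compl _ S T) z

theorem potential_mono (s : ℝ) (w : ℝ → ℝ) {S T : Set ℝ} (h : S ⊆ T) (z : ℝ) :
    potential s w S z ≤ potential s w T z :=
  lcorr_mono (fun t => indicator_le_indicator_of_subset h (fun _ => zero_le) t) z

theorem tendsto_potential {s : ℝ} {w : ℝ → ℝ} {z : ℝ} (h : potential s w univ z ≠ ∞) :
    Tendsto (fun L : ℝ => potential s w (Ioc (-L) L) z) atTop (𝓝 (potential s w univ z)) := by
  unfold potential lcorr
  refine tendsto_lintegral_filter_of_dominated_convergence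
    (fun t => ENNReal.ofReal (deriv w (z + t)) * kern (2 * s - 1) univ t) ?_ ?_ h ?_
  · refine Eventually.of_forall fun L => ?_
    have := measurable_kern (2 * s - 1) (measurableSet_Ioc (a := -L) (b := L))
    fun_prop
  · exact Eventually.of_forall fun L => ae_of_all _ fun t => mul_le_mul_right
      (indicator_le_indicator_of_subset (subset_univ _) (fun _ => zero_le) t) _
  · refine ae_of_all _ fun t => tendsto_const_nhds.congr' ?_
    filter_upwards [eventually_gt_atTop |t|] with L hL
    have : t ∈ Ioc (-L) L := ⟨(abs_lt.1 hL).1, (abs_lt.1 hL).2.le⟩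
    simp [kern, this]

namespace IsOptimalProfile

variable {s : ℝ} {W w : ℝ → ℝ}

theorem exists_potential_near_le (hW : IsDoubleWell W) (hw : IsOptimalProfile s W w)
    (h0 : 1 / 2 < s) (h1 : s < 1) :
    ∃ C : ℝ, ∀ z, potential s w (Ioc (-1) 1) z ≤ ENNReal.ofReal C := by
  obtain ⟨C, hC⟩ := hw.exists_nearPotential_le hW h0 h1
  refine ⟨C, fun z => ?_⟩
  rw [potential, lcorr_kern_Ioc_eq hw.continuous_deriv hw.deriv_nonneg (by linarith)]
  exact ENNReal.ofReal_le_ofReal (hC z)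

theorem lintegral_potential_near_sq_lt_top (hW : IsDoubleWell W) (hw : IsOptimalProfile s W w)
    (h0 : 1 / 2 < s) (h1 : s < 1) : ∫⁻ z, potential s w (Ioc (-1) 1) z ^ 2 < ∞ := by
  obtain ⟨C, hC⟩ := hw.exists_potential_near_le hW h0 h1
  have hk := measurable_kern (2 * s - 1) (measurableSet_Ioc (a := (-1 : ℝ)) (b := 1))
  calc ∫⁻ z, potential s w (Ioc (-1) 1) z ^ 2
      ≤ ∫⁻ z, ENNReal.ofReal C * potential s w (Ioc (-1) 1) z :=
        lintegral_mono fun z => by rw [sq]; exact mul_le_mul_left (hC z) _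
    _ = ENNReal.ofReal C * ∫⁻ z, potential s w (Ioc (-1) 1) z :=
        lintegral_const_mul _ (measurable_potential s w measurableSet_Ioc)
    _ ≤ ENNReal.ofReal C * (2 * ∫⁻ t, kern (2 * s - 1) (Ioc (-1) 1) t) := by
        gcongr
        rw [← hw.lintegral_deriv]
        exact lintegral_lcorr_le (by fun_prop) hk
    _ < ∞ := by
        have := lintegral_kern_Ioc_lt_top (show 2 * s - 1 < 1 by linarith)
        finiteness

theorem potential_far_le (hw : IsOptimalProfile s W w) (h0 : 1 / 2 < s) (z : ℝ) :
    potential s w (Ioc (-1) 1)ᶜ z ≤ 2 := by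
  have := lcorr_le_of_le (φ := fun t => ENNReal.ofReal (deriv w t)) (by fun_prop)
    (kern_compl_le_one (show 0 ≤ 2 * s - 1 by linarith)) z
  rwa [hw.lintegral_deriv, mul_one] at this

theorem potential_far_sq_le (hw : IsOptimalProfile s W w) (z : ℝ) :
    potential s w (Ioc (-1) 1)ᶜ z ^ 2 ≤ 2 * lcorr (fun t => ENNReal.ofReal (deriv w t))
      (fun t => kern (2 * s - 1) (Ioc (-1) 1)ᶜ t ^ 2) z := by
  have := lcorr_sq_le (φ := fun t => ENNReal.ofReal (deriv w t)) (by fun_prop)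
    (measurable_kern (2 * s - 1) (measurableSet_Ioc (a := (-1 : ℝ)) (b := 1)).compl) z
  rwa [hw.lintegral_deriv] at this

theorem setLIntegral_potential_far_sq_le (hw : IsOptimalProfile s W w) {E : Set ℝ} {C : ℝ≥0∞}
    (h : ∀ y, ∫⁻ z in E, kern (2 * s - 1) (Ioc (-1) 1)ᶜ (y - z) ^ 2 ≤ C) :
    ∫⁻ z in E, potential s w (Ioc (-1) 1)ᶜ z ^ 2 ≤ 4 * C := by
  have hk : Measurable fun t => kern (2 * s - 1) (Ioc (-1) 1)ᶜ t ^ 2 :=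
    (measurable_kern (2 * s - 1) (measurableSet_Ioc (a := (-1 : ℝ)) (b := 1)).compl).pow_const 2
  calc _ ≤ ∫⁻ z in E, 2 * lcorr (fun t => ENNReal.ofReal (deriv w t))
        (fun t => kern (2 * s - 1) (Ioc (-1) 1)ᶜ t ^ 2) z :=
        lintegral_mono fun z => hw.potential_far_sq_le z
    _ = 2 * ∫⁻ z in E, lcorr (fun t => ENNReal.ofReal (deriv w t))
        (fun t => kern (2 * s - 1) (Ioc (-1) 1)ᶜ t ^ 2) z :=
        lintegral_const_mul _ (measurable_lcorr (by fun_prop) hk)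
    _ ≤ 2 * (2 * C) := by
        gcongr
        have := setLIntegral_lcorr_le (φ := fun t => ENNReal.ofReal (deriv w t)) (by fun_prop) hk h
        rwa [hw.lintegral_deriv] at this
    _ = 4 * C := by rw [← mul_assoc]; norm_num

theorem potential_lt_top (hW : IsDoubleWell W) (hw : IsOptimalProfile s W w) (h0 : 1 / 2 < s)
    (h1 : s < 1) (S : Set ℝ) (z : ℝ) : potential s w S z < ∞ := by
  obtain ⟨C, hC⟩ := hw.exists_potential_near_le hW h0 h1
  refine (potential_le_add_compl s w S measurableSet_Ioc z).trans_lt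
    ((add_le_add (hC z) (hw.potential_far_le h0 z)).trans_lt (by finiteness))

theorem setLIntegral_potential_sq_le (hW : IsDoubleWell W) (hw : IsOptimalProfile s W w)
    (h0 : 1 / 2 < s) (h1 : s < 1) (S E : Set ℝ) {δ : ℝ} (hδ : 0 < δ) :
    ∫⁻ z in E, potential s w S z ^ 2 ≤
      ENNReal.ofReal (1 + δ) * (∫⁻ z in E, potential s w (Ioc (-1) 1)ᶜ z ^ 2) +
        ENNReal.ofReal (1 + δ⁻¹) * ∫⁻ z in E, potential s w (Ioc (-1) 1) z ^ 2 := by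
  have hlt : ∀ S z, potential s w S z < ∞ := hw.potential_lt_top hW h0 h1
  have m1 := (measurable_potential s w (measurableSet_Ioc (a := (-1 : ℝ)) (b := 1))).pow_const 2
  have m2 := (measurable_potential s w
    (measurableSet_Ioc (a := (-1 : ℝ)) (b := 1)).compl).pow_const 2
  rw [← lintegral_const_mul _ m1, ← lintegral_const_mul _ m2, ← lintegral_add_left (m2.const_mul _)]
  refine lintegral_mono fun z => ?_
  exact (pow_le_pow_left' (potential_le_add_compl s w S measurableSet_Ioc z) 2).trans
    (add_sq_le_weighted (hlt _ z).ne (hlt _ z).ne hδ)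

theorem lintegral_potential_sq_lt_top (hW : IsDoubleWell W) (hw : IsOptimalProfile s W w)
    (h0 : 3 / 4 < s) (h1 : s < 1) : ∫⁻ z, potential s w univ z ^ 2 < ∞ := by
  have hfar : ∫⁻ z, potential s w (Ioc (-1) 1)ᶜ z ^ 2 < ∞ := by
    have := hw.setLIntegral_potential_far_sq_le (E := univ)
      (C := ∫⁻ t, kern (2 * s - 1) (Ioc (-1) 1)ᶜ t ^ 2) (fun y => by
        rw [Measure.restrict_univ,
          lintegral_sub_left_eq_self (fun t => kern (2 * s - 1) (Ioc (-1) 1)ᶜ t ^ 2)])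
    rw [Measure.restrict_univ] at this
    have h := lintegral_kern_compl_sq_lt_top (show 1 / 2 < 2 * s - 1 by linarith)
    exact this.trans_lt (by finiteness)
  have hnear := hw.lintegral_potential_near_sq_lt_top hW (by linarith) h1
  have := hw.setLIntegral_potential_sq_le hW (by linarith) h1 univ univ one_pos
  simp only [Measure.restrict_univ] at this
  exact this.trans_lt (by finiteness)

/-- The kernel is positive off the origin, so a zero value would force `w' = 0` almost everywhere,
against mass `2`. -/
theorem potential_univ_pos (hw : IsOptimalProfile s W w) (z : ℝ) : 0 < potential s w univ z := by
  rw [pos_iff_ne_zero]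
  intro h
  unfold potential lcorr at h
  have hk := measurable_kern (2 * s - 1) MeasurableSet.univ
  rw [lintegral_eq_zero_iff (by fun_prop)] at h
  have h2 := hw.lintegral_deriv
  rw [← lintegral_add_left_eq_self _ z] at h2
  have h3 : (fun t => ENNReal.ofReal (deriv w (z + t))) =ᵐ[volume] 0 := by
    filter_upwards [h, Measure.ae_ne volume 0] with t ht ht0
    rcases mul_eq_zero.1 ht with h' | h'
    · exact h'
    · simp only [kern, indicator_univ, ENNReal.ofReal_eq_zero] at h'
      exact absurd h' (not_le.2 (Real.rpow_pos_of_pos (abs_pos.2 ht0) _))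
  rw [lintegral_congr_ae h3] at h2
  simp at h2

theorem integrable_potential_sq (hW : IsDoubleWell W) (hw : IsOptimalProfile s W w)
    (h0 : 3 / 4 < s) (h1 : s < 1) :
    Integrable fun z => (potential s w univ z).toReal ^ 2 := by
  have := integrable_toReal_of_lintegral_ne_top
    (((measurable_potential s w MeasurableSet.univ).pow_const 2).aemeasurable (μ := volume))
    (hw.lintegral_potential_sq_lt_top hW h0 h1).ne
  simpa only [ENNReal.toReal_pow] using this

theorem potentialMass_pos (hW : IsDoubleWell W) (hw : IsOptimalProfile s W w)
    (h0 : 3 / 4 < s) (h1 : s < 1) : 0 < potentialMass s w := by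
  unfold potentialMass
  rw [integral_pos_iff_support_of_nonneg (fun z => sq_nonneg _)
    (hw.integrable_potential_sq hW h0 h1)]
  have : Function.support (fun z => (potential s w univ z).toReal ^ 2) = univ := by
    ext z
    have := ENNReal.toReal_pos (hw.potential_univ_pos z).ne'
      (hw.potential_lt_top hW (by linarith) h1 univ z).ne
    simpa using this.ne'
  rw [this]
  simp

theorem eta_eq_potential (hw : IsOptimalProfile s W w) {L : ℝ} (hL : 0 ≤ L) (z : ℝ) :
    eta s w 1 L z = (potential s w (Ioc (-L) L) z).toReal :=
  eta_eq_toReal hw.deriv_nonneg hL z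

theorem tendsto_integral_eta_sq (hW : IsDoubleWell W) (hw : IsOptimalProfile s W w)
    (h0 : 3 / 4 < s) (h1 : s < 1) {l l' : ℝ} (hl : 0 < l) (hl' : 0 < l') :
    Tendsto (fun ε : ℝ => ∫ z in (-(l' / ε))..(l' / ε), (eta s w 1 (l / ε) z) ^ 2)
      (𝓝[>] 0) (𝓝 (potentialMass s w)) := by
  have hdiv : ∀ c : ℝ, 0 < c → Tendsto (fun ε : ℝ => c / ε) (𝓝[>] 0) atTop := fun c hc => by
    simpa only [div_eq_mul_inv] using tendsto_inv_nhdsGT_zero.const_mul_atTop hc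
  have hlt : ∀ S z, potential s w S z < ∞ := hw.potential_lt_top hW (by linarith) h1
  have key : Tendsto (fun ε : ℝ => ∫ z, (Ioc (-(l' / ε)) (l' / ε)).indicator
      (fun z => (potential s w (Ioc (-(l / ε)) (l / ε)) z).toReal ^ 2) z)
      (𝓝[>] 0) (𝓝 (potentialMass s w)) := by
    refine tendsto_integral_filter_of_dominated_convergence
      (fun z => (potential s w univ z).toReal ^ 2) ?_ ?_ (hw.integrable_potential_sq hW h0 h1) ?_
    · exact Eventually.of_forall fun ε => (((measurable_potential s w
        measurableSet_Ioc).ennreal_toReal.pow_const 2).indicator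
          measurableSet_Ioc).aestronglyMeasurable
    · refine Eventually.of_forall fun ε => ae_of_all _ fun z => ?_
      refine (norm_indicator_le_norm_self _ _).trans ?_
      rw [Real.norm_of_nonneg (sq_nonneg _)]
      have := ENNReal.toReal_mono (hlt univ z).ne
        (potential_mono s w (subset_univ (Ioc (-(l / ε)) (l / ε))) z)
      gcongr
    · refine ae_of_all _ fun z => ?_
      have h2 := (((ENNReal.tendsto_toReal (hlt univ z).ne).comp
        (tendsto_potential (hlt univ z).ne)).comp (hdiv l hl)).pow 2
      refine h2.congr' ?_
      filter_upwards [(hdiv l' hl').eventually_gt_atTop |z|] with ε hε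
      rw [indicator_of_mem]
      · rfl
      · exact ⟨(abs_lt.1 hε).1, (abs_lt.1 hε).2.le⟩
  refine key.congr' ?_
  filter_upwards [self_mem_nhdsWithin] with ε hε
  have hε : 0 < ε := hε
  rw [integral_indicator measurableSet_Ioc, intervalIntegral.integral_of_le
    (by have : 0 < l' / ε := by positivity
        linarith)]
  simp only [hw.eta_eq_potential (show 0 ≤ l / ε by positivity)]

end IsOptimalProfile

/-! ### The critical exponent `s = 3/4`. -/

theorem setLIntegral_Ioc_inv_add {A B m : ℝ} (hA : 0 < A) (hAB : A ≤ B) (hm : 0 ≤ m) :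
    ∫⁻ z in Ioc A B, ENNReal.ofReal (m * (|z| + A)⁻¹) =
      ENNReal.ofReal (m * Real.log ((B + A) / (2 * A))) := by
  have e : ∫ z in A..B, m * (z + A)⁻¹ = m * Real.log ((B + A) / (2 * A)) := by
    rw [intervalIntegral.integral_const_mul,
      intervalIntegral.integral_comp_add_right (fun z => z⁻¹), integral_inv_of_pos (by linarith)
      (by linarith), two_mul]
  have hi : IntervalIntegrable (fun z => m * (z + A)⁻¹) volume A B := by
    refine ContinuousOn.intervalIntegrable fun z hz => ContinuousAt.continuousWithinAt ?_
    rw [uIcc_of_le hAB] at hz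
    have : z + A ≠ 0 := by linarith [hz.1]
    fun_prop (disch := assumption)
  rw [← e, intervalIntegral.integral_of_le hAB, ofReal_integral_eq_lintegral_ofReal hi.1]
  · refine setLIntegral_congr_fun measurableSet_Ioc fun z hz => ?_
    simp only [abs_of_pos (hA.trans hz.1)]
  · filter_upwards [self_mem_ae_restrict measurableSet_Ioc] with z hz
    exact mul_nonneg hm (inv_nonneg.2 (by linarith [hz.1]))

theorem tendsto_add_div_abs_log (a K : ℝ) :
    Tendsto (fun ε : ℝ => a + K / |Real.log ε|) (𝓝[>] 0) (𝓝 a) := by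
  have h := (tendsto_abs_atBot_atTop.comp Real.tendsto_log_nhdsGT_zero).const_div_atTop K
  simpa using h.const_add a

namespace IsOptimalProfile

variable {s : ℝ} {W w : ℝ → ℝ}

/-- Only the mass of `w'` in `(-A, A]` is kept: it lies within distance `|z| + A` of `z`, hence
inside the window, and the kernel is decreasing in distance. -/
theorem ofReal_le_potential (hw : IsOptimalProfile s W w) (h0 : 1 / 2 < s) {A L z : ℝ} (hA : 0 < A)
    (hz : A < |z|) (hzL : |z| + A ≤ L) :
    ENNReal.ofReal ((w A - w (-A)) * (|z| + A) ^ (-(2 * s - 1))) ≤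
      potential s w (Ioc (-L) L) z := by
  have hAA : -A ≤ A := by linarith
  have hm : ∫⁻ t in Ioc (-A - z) (A - z), ENNReal.ofReal (deriv w (z + t)) =
      ENNReal.ofReal (w A - w (-A)) := by
    rw [← hw.integral_deriv, intervalIntegral.integral_of_le hAA, ofReal_integral_eq_lintegral_ofReal
      hw.continuous_deriv.integrableOn_Ioc (ae_of_all _ hw.deriv_nonneg),
      ← (measurePreserving_add_left volume z).setLIntegral_comp_preimage_emb
        (MeasurableEquiv.addLeft z).measurableEmbedding _ (Ioc (-A) A)]
    simp
  rw [ENNReal.ofReal_mul (sub_nonneg.2 (hw.strictMono.monotone hAA)), ← hm, potential,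
    lcorr_kern_eq _ _ measurableSet_Ioc, ← lintegral_mul_const _ (by fun_prop)]
  have hz1 := le_abs_self z
  have hz2 := neg_le_abs z
  refine le_trans (setLIntegral_mono' measurableSet_Ioc fun t ht => ?_)
    (lintegral_mono_set (Ioc_subset_Ioc (by linarith) (by linarith)))
  refine mul_le_mul_right (ENNReal.ofReal_le_ofReal ?_) _
  have ht0 : 0 < |t| := by
    rw [abs_pos]
    rintro rfl
    have : |z| ≤ A := abs_le.2 ⟨by linarith [ht.2, ht.1], by linarith [ht.1, ht.2]⟩
    linarith
  have htz : |t| ≤ |z| + A := abs_le.2 ⟨by linarith [ht.1], by linarith [ht.2]⟩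
  exact Real.rpow_le_rpow_of_nonpos ht0 htz (by linarith)

theorem integral_eta_sq_eq (hW : IsDoubleWell W) (hw : IsOptimalProfile s W w) (h0 : 1 / 2 < s)
    (h1 : s < 1) {L R : ℝ} (hL : 0 ≤ L) (hR : 0 ≤ R) :
    ∫ z in (-R)..R, eta s w 1 L z ^ 2 =
      (∫⁻ z in Ioc (-R) R, potential s w (Ioc (-L) L) z ^ 2).toReal := by
  simp only [hw.eta_eq_potential hL]
  rw [intervalIntegral.integral_of_le (by linarith), integral_eq_lintegral_of_nonneg_ae
    (ae_of_all _ fun z => sq_nonneg _)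
    ((measurable_potential s w measurableSet_Ioc).ennreal_toReal.pow_const 2).aestronglyMeasurable]
  congr 1
  refine lintegral_congr fun z => ?_
  rw [ENNReal.ofReal_pow ENNReal.toReal_nonneg,
    ENNReal.ofReal_toReal (hw.potential_lt_top hW h0 h1 _ _).ne]

theorem lintegral_potential_sq_le (hW : IsDoubleWell W) (hw : IsOptimalProfile (3 / 4) W w)
    {δ : ℝ} (hδ : 0 < δ) : ∃ K : ℝ, 0 ≤ K ∧ ∀ (S : Set ℝ) (R : ℝ), 1 ≤ R →
      ∫⁻ z in Ioc (-R) R, potential (3 / 4) w S z ^ 2 ≤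
        ENNReal.ofReal ((1 + δ) * (8 * Real.log R + 8) + K) := by
  have hnear := hw.lintegral_potential_near_sq_lt_top hW (by norm_num) (by norm_num)
  set I := ∫⁻ z, potential (3 / 4) w (Ioc (-1) 1) z ^ 2
  have hδ' : 0 < δ⁻¹ := inv_pos.2 hδ
  have hK : 0 ≤ (1 + δ⁻¹) * I.toReal := mul_nonneg (by linarith) ENNReal.toReal_nonneg
  refine ⟨(1 + δ⁻¹) * I.toReal, hK, fun S R hR => ?_⟩
  refine (hw.setLIntegral_potential_sq_le hW (by norm_num) (by norm_num) S _ hδ).trans ?_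
  have hlog := Real.log_nonneg hR
  have hfar : ∫⁻ z in Ioc (-R) R, potential (3 / 4) w (Ioc (-1) 1)ᶜ z ^ 2 ≤
      ENNReal.ofReal (8 * Real.log R + 8) := by
    have := hw.setLIntegral_potential_far_sq_le (E := Ioc (-R) R) (fun y => by
      rw [show (2 * (3 / 4) - 1 : ℝ) = 1 / 2 by norm_num]
      exact setLIntegral_kern_half_compl_sq_le hR y)
    refine this.trans_eq ?_
    rw [show (4 : ℝ≥0∞) = ENNReal.ofReal 4 by simp, ← ENNReal.ofReal_mul (by norm_num)]
    congr 1; ring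
  rw [ENNReal.ofReal_add (mul_nonneg (by linarith) (by linarith)) hK,
    ENNReal.ofReal_mul (by linarith), ENNReal.ofReal_mul (by linarith),
    ENNReal.ofReal_toReal hnear.ne]
  gcongr
  exact setLIntegral_le_lintegral _ _

theorem le_lintegral_potential_sq (hw : IsOptimalProfile (3 / 4) W w) {A B L R : ℝ} (hA : 0 < A)
    (hAB : A ≤ B) (hBL : B + A ≤ L) (hBR : B < R) :
    ENNReal.ofReal (2 * (w A - w (-A)) ^ 2 * Real.log ((B + A) / (2 * A))) ≤
      ∫⁻ z in Ioc (-R) R, potential (3 / 4) w (Ioc (-L) L) z ^ 2 := by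
  set m := w A - w (-A) with hm
  have hm0 : 0 ≤ m := sub_nonneg.2 (hw.strictMono.monotone (by linarith))
  have hpt : ∀ z, A < |z| → |z| ≤ B → ENNReal.ofReal (m ^ 2 * (|z| + A)⁻¹) ≤
      potential (3 / 4) w (Ioc (-L) L) z ^ 2 := fun z h1 h2 => by
    have h := pow_le_pow_left' (hw.ofReal_le_potential (by norm_num) (L := L) hA h1 (by linarith)) 2
    have hp : 0 ≤ |z| + A := by linarith [abs_nonneg z]
    rw [← ENNReal.ofReal_pow (mul_nonneg hm0 (Real.rpow_nonneg hp _)), mul_pow,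
      ← Real.rpow_mul_natCast hp] at h
    norm_num [Real.rpow_neg_one] at h
    exact h
  have h1 : ENNReal.ofReal (m ^ 2 * Real.log ((B + A) / (2 * A))) ≤
      ∫⁻ z in Ioc A B, potential (3 / 4) w (Ioc (-L) L) z ^ 2 := by
    rw [← setLIntegral_Ioc_inv_add hA hAB (sq_nonneg m)]
    refine setLIntegral_mono' measurableSet_Ioc fun z hz => hpt z ?_ ?_ <;>
      rw [abs_of_pos (hA.trans hz.1)]
    exacts [hz.1, hz.2]
  have h2 : ENNReal.ofReal (m ^ 2 * Real.log ((B + A) / (2 * A))) ≤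
      ∫⁻ z in Ico (-B) (-A), potential (3 / 4) w (Ioc (-L) L) z ^ 2 := by
    rw [← setLIntegral_Ioc_inv_add hA hAB (sq_nonneg m),
      ← (Measure.measurePreserving_neg (volume : Measure ℝ)).setLIntegral_comp_preimage_emb
      (MeasurableEquiv.neg ℝ).measurableEmbedding _ (Ico (-B) (-A))]
    simp only [neg_preimage, neg_Ico, neg_neg]
    refine setLIntegral_mono' measurableSet_Ioc fun z hz => ?_
    rw [← abs_neg]
    refine hpt (-z) ?_ ?_ <;> rw [abs_neg, abs_of_pos (hA.trans hz.1)]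
    exacts [hz.1, hz.2]
  have hlog : 0 ≤ Real.log ((B + A) / (2 * A)) :=
    Real.log_nonneg ((one_le_div (by linarith)).2 (by linarith))
  calc _ = ENNReal.ofReal (m ^ 2 * Real.log ((B + A) / (2 * A))) +
        ENNReal.ofReal (m ^ 2 * Real.log ((B + A) / (2 * A))) := by
        rw [← ENNReal.ofReal_add (by positivity) (by positivity)]; congr 1; ring
    _ ≤ _ := add_le_add h1 h2
    _ = ∫⁻ z in Ioc A B ∪ Ico (-B) (-A), potential (3 / 4) w (Ioc (-L) L) z ^ 2 := by
        rw [lintegral_union measurableSet_Ico]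
        rw [Set.disjoint_left]
        intro z hz hz'
        linarith [hz.1, hz'.2]
    _ ≤ _ := by
        refine lintegral_mono_set (union_subset (fun z hz => ?_) fun z hz => ?_)
        · exact ⟨by linarith [hz.1], by linarith [hz.2]⟩
        · exact ⟨by linarith [hz.1], by linarith [hz.2]⟩

theorem tendsto_integral_eta_sq_div_log (hW : IsDoubleWell W) (hw : IsOptimalProfile (3 / 4) W w)
    {l l' : ℝ} (hl : 0 < l) (hl' : 0 < l') :
    Tendsto (fun ε : ℝ => 1 / |Real.log ε| *
      ∫ z in (-(l' / ε))..(l' / ε), (eta (3 / 4) w 1 (l / ε) z) ^ 2) (𝓝[>] 0) (𝓝 8) := by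
  have hpos : ∀ᶠ ε in 𝓝[>] (0 : ℝ), 0 < ε ∧ ε < 1 := Ioo_mem_nhdsGT one_pos
  have hdiv : ∀ c : ℝ, 0 < c → Tendsto (fun ε : ℝ => c / ε) (𝓝[>] 0) atTop := fun c hc => by
    simpa only [div_eq_mul_inv] using tendsto_inv_nhdsGT_zero.const_mul_atTop hc
  refine tendsto_order.2 ⟨fun b hb => ?_, fun b hb => ?_⟩
  · have hlimA : Tendsto (fun A : ℝ => 2 * (w A - w (-A)) ^ 2) atTop (𝓝 8) := by
      have := ((hw.tendsto_atTop.sub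
        (hw.tendsto_atBot.comp tendsto_neg_atTop_atBot)).pow 2).const_mul 2
      norm_num at this
      exact this
    obtain ⟨A, hAb, hA⟩ := ((hlimA.eventually (lt_mem_nhds hb)).and (eventually_gt_atTop 0)).exists
    set M := 2 * (w A - w (-A)) ^ 2 with hM
    set c := min l l' with hc
    have hc0 : 0 < c := lt_min hl hl'
    have hlt := (tendsto_add_div_abs_log M (M * Real.log (c / (2 * A)))).eventually
      (lt_mem_nhds hAb)
    -- Used only for finiteness, so that `toReal` preserves the lower bound.
    obtain ⟨K, _, hK⟩ := hw.lintegral_potential_sq_le hW one_pos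
    filter_upwards [hlt, hpos, (hdiv c hc0).eventually_ge_atTop (2 * A),
      (hdiv l' hl').eventually_ge_atTop 1] with ε h1 hε h2 h3
    refine h1.trans_le ?_
    obtain ⟨hε0, hε1⟩ := hε
    have hlog : 0 < |Real.log ε| := abs_pos.2 (Real.log_neg hε0 hε1).ne
    have hcl : c / ε ≤ l / ε := by gcongr; exact min_le_left _ _
    have hcl' : c / ε ≤ l' / ε := by gcongr; exact min_le_right _ _
    -- With this `B` the logarithm is exactly `log (c / (2A)) + |log ε|`, and `c = min l l'`
    -- respects both cutoffs.
    have hlow := hw.le_lintegral_potential_sq (A := A) (B := c / ε - A) (L := l / ε) (R := l' / ε)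
      hA (by linarith) (by linarith) (by linarith)
    rw [hw.integral_eta_sq_eq hW (by norm_num) (by norm_num) (by positivity) (by positivity),
      one_div, ← div_eq_inv_mul, le_div_iff₀ hlog, add_mul, div_mul_cancel₀ _ hlog.ne']
    rw [← ENNReal.ofReal_le_iff_le_toReal ((hK _ _ h3).trans_lt ENNReal.ofReal_lt_top).ne]
    refine le_of_eq_of_le ?_ hlow
    congr 1
    rw [sub_add_cancel, show c / ε / (2 * A) = c / (2 * A) / ε by ring,
      Real.log_div (by positivity) hε0.ne', abs_of_neg (Real.log_neg hε0 hε1)]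
    ring
  -- With `δ = (b - 8)/16` the leading coefficient is the midpoint of `8` and `b`.
  · obtain ⟨δ, hδ, hδb⟩ : ∃ δ : ℝ, 0 < δ ∧ (1 + δ) * 8 < b :=
      ⟨(b - 8) / 16, by linarith, by linarith⟩
    obtain ⟨K, hK0, hK⟩ := hw.lintegral_potential_sq_le hW hδ
    have hlt := (tendsto_add_div_abs_log ((1 + δ) * 8)
      ((1 + δ) * (8 * Real.log l' + 8) + K)).eventually (gt_mem_nhds hδb)
    filter_upwards [hlt, hpos, (hdiv l' hl').eventually_ge_atTop 1] with ε h1 hε h3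
    refine lt_of_le_of_lt ?_ h1
    obtain ⟨hε0, hε1⟩ := hε
    have hlog : 0 < |Real.log ε| := abs_pos.2 (Real.log_neg hε0 hε1).ne
    have hlog3 := Real.log_nonneg h3
    rw [hw.integral_eta_sq_eq hW (by norm_num) (by norm_num) (by positivity) (by positivity),
      one_div, ← div_eq_inv_mul, div_le_iff₀ hlog, add_mul, div_mul_cancel₀ _ hlog.ne']
    refine (ENNReal.toReal_le_of_le_ofReal (by positivity) (hK _ _ h3)).trans_eq ?_
    rw [Real.log_div hl'.ne' hε0.ne', abs_of_neg (Real.log_neg hε0 hε1)]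
    ring

end IsOptimalProfile
end FracAllenCahn

theorem proposition5p3 :
    (∀ s : ℝ, 3 / 4 < s → s < 1 →
      ∃ μ : (ℝ → ℝ) → ℝ, ∀ W w : ℝ → ℝ,
        FracAllenCahn.IsDoubleWell W → FracAllenCahn.IsOptimalProfile s W w →
        0 < μ w ∧
        ∀ l l' : ℝ, 0 < l → 0 < l' →
          Tendsto
            (fun ε : ℝ => ∫ z in (-(l' / ε))..(l' / ε), (FracAllenCahn.eta s w 1 (l / ε) z) ^ 2)
            (𝓝[>] 0) (𝓝 (μ w))) ∧
    (∀ W w : ℝ → ℝ,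
      FracAllenCahn.IsDoubleWell W → FracAllenCahn.IsOptimalProfile (3 / 4) W w →
      ∀ l l' : ℝ, 0 < l → 0 < l' →
        Tendsto
          (fun ε : ℝ => 1 / |Real.log ε| *
            ∫ z in (-(l' / ε))..(l' / ε), (FracAllenCahn.eta (3 / 4) w 1 (l / ε) z) ^ 2)
          (𝓝[>] 0) (𝓝 8)) :=
  ⟨fun s h0 h1 => ⟨FracAllenCahn.potentialMass s, fun _ _ hW hw =>
    ⟨hw.potentialMass_pos hW h0 h1, fun _ _ hl hl' => hw.tendsto_integral_eta_sq hW h0 h1 hl hl'⟩⟩,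
    fun _ _ hW hw _ _ hl hl' => hw.tendsto_integral_eta_sq_div_log hW hl hl'⟩
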